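/- Let $n\ge 0$ and let $X\in\mathbb{C}^{n\times n}$ have no eigenvalues on $(-\infty,0]$. A principal logarithm of $X$ is a matrix $L\in\mathbb{C}^{n\times n}$ with $e^{L}=X$ all of whose eigenvalues lie in the strip $\{z\in\mathbb{C}:-\pi<\operatorname{Im}z<\pi\}$. Then $X$ has exactly one principal logarithm $L$, and the following hold, where $\top$ denotes transpose and $\dagger$ conjugate transpose. 1. If $X$ is unitary, then $L^{\dagger}=-L$. 2. If $X$ is complex symmetric ($X^{\top}=X$), then $L$ is complex symmetric. 3. If all entries of $X$ are real, then all entries of $L$ are real. 4. Suppose $n=2m$ is even, let $Z=\begin{pmatrix}0&I_m\\-I_m&0\end{pmatrix}$, and put $Y^{\sharp}=-ZY^{\top}Z$ for $Y\in\mathbb{C}^{n\times n}$. If $X$ is self-dual ($X^{\sharp}=X$), then $L$ is self-dual ($L^{\sharp}=L$). 5. For every unitary $\Gamma\in\mathbb{C}^{n\times n}$ with $\Gamma^{2}=I$: if $\Gamma X\Gamma=X^{\dagger}$, then $\Gamma L\Gamma=L^{\dagger}$. -/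

import Mathlib

namespace MatrixLog

/-- `X` has no eigenvalue on the closed negative half-line `(-∞, 0]`. -/
def NoNonposEigenvalue {n : ℕ} (X : Matrix (Fin n) (Fin n) ℂ) : Prop :=
  ∀ x : ℝ, x ≤ 0 → ¬ Module.End.HasEigenvalue (Matrix.toLin' X) (x : ℂ)

/-- `L` is a principal logarithm of `X`: a logarithm, `e ^ L = X`, all of whose eigenvalues lie in
the open strip `-π < Im z < π`. -/
structure IsPrincipalLog {n : ℕ} (X L : Matrix (Fin n) (Fin n) ℂ) : Prop where
  exp_eq : NormedSpace.exp L = X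
  eigenvalue_im : ∀ z : ℂ, Module.End.HasEigenvalue (Matrix.toLin' L) z →
    -Real.pi < z.im ∧ z.im < Real.pi

/-- All entries of the complex matrix `X` are real. -/
def IsRealMatrix {n : ℕ} (X : Matrix (Fin n) (Fin n) ℂ) : Prop :=
  ∀ i j, (X i j).im = 0

/-- The `n × n` matrix with `m × m` blocks `[0, I; -I, 0]`, where `n = m + m`. -/
def Z {m n : ℕ} (h : m + m = n) : Matrix (Fin n) (Fin n) ℂ :=
  Matrix.reindex (finSumFinEquiv.trans (finCongr h)) (finSumFinEquiv.trans (finCongr h))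
    (Matrix.fromBlocks 0 1 (-1) 0)

/-- The dual operation `X ↦ -Z Xᵀ Z` on matrices of even size `n = m + m`. -/
def dual {m n : ℕ} (h : m + m = n) (X : Matrix (Fin n) (Fin n) ℂ) : Matrix (Fin n) (Fin n) ℂ :=
  -(Z h * X.transpose * Z h)

/-- `X` is self-dual: it equals its dual. -/
def IsSelfDual {m n : ℕ} (h : m + m = n) (X : Matrix (Fin n) (Fin n) ℂ) : Prop :=
  dual h X = X

end MatrixLog

/-!
In any complex Banach algebra, `exp` maps the elements with spectrum in the strip `-π < Im z < π`
bijectively onto the elements with spectrum in the slit plane.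

In a commutative algebra, every character sends `∫₀¹ (x - 1) (1 + t (x - 1))⁻¹ dt` to the principal
logarithm of its value at `x`, so by Gelfand theory this integral is a logarithm of `x` with
spectrum in the strip. If `a` and `b` are two such logarithms, the characters agree on them, so
`d = a - b` is killed by every character. In `d * ∫₀¹ exp (s d) ds = exp d - 1 = 0` the integral is
then sent to `1` by every character, hence is a unit, and `d = 0`.

A general algebra reduces to this case because the double centralizer of commuting elements is
commutative and closed under inverses, hence spectra agree in it. The logarithm of `x` found in the
double centralizer of `x` commutes with every other logarithm of `x`.

The symmetries of a principal logarithm follow from uniqueness: transposition, conjugate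
transposition, inversion and conjugation of `X` are matched by transposition, conjugate
transposition, negation and conjugation of `L`, and these preserve the strip.
-/

namespace MatrixLog

open NormedSpace Set WeakDual
open Complex (slitPlane)
open scoped Matrix Ring

section Exp

variable {A : Type*} [NormedRing A] [NormedAlgebra ℝ A] [CompleteSpace A]

theorem intervalIntegrable_exp_smul (d : A) (a b : ℝ) :
    IntervalIntegrable (fun s : ℝ ↦ exp (s • d)) MeasureTheory.volume a b :=
  (differentiable_exp_smul_const ℝ d).continuous.intervalIntegrable a b

theorem mul_integral_exp_smul (d : A) : d * ∫ s in (0 : ℝ)..1, exp (s • d) = exp d - 1 := by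
  let _ : NormedAlgebra ℚ A := .restrictScalars ℚ ℝ A
  have hint := intervalIntegrable_exp_smul d 0 1
  calc d * ∫ s in (0 : ℝ)..1, exp (s • d)
      = ∫ s in (0 : ℝ)..1, d * exp (s • d) :=
        ((ContinuousLinearMap.mul ℝ A d).intervalIntegral_comp_comm hint).symm
    _ = exp ((1 : ℝ) • d) - exp ((0 : ℝ) • d) :=
        intervalIntegral.integral_eq_sub_of_hasDerivAt
          (fun s _ ↦ hasDerivAt_exp_smul_const' d s) (hint.const_mul d)
    _ = exp d - 1 := by rw [one_smul, zero_smul, exp_zero]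

end Exp

section IntegralLog

variable {B : Type*} [NormedCommRing B] [NormedAlgebra ℝ B]

/-- The integrand `(x - 1) (1 + t (x - 1))⁻¹` whose integral over `0 ≤ t ≤ 1` is the principal
logarithm of `x`. `Ring.inverse` is `0` at non-units, so this is meaningful only for `t` at which
`1 + t (x - 1)` is invertible. -/
noncomputable def logIntegrand (x : B) (t : ℝ) : B :=
  (x - 1) * (1 + t • (x - 1))⁻¹ʳ

/-- The logarithm of `x` obtained by integrating `dz / z` along the segment from `1` to `x`. It is
meaningful only if that segment consists of invertible elements. -/
noncomputable def integralLog (x : B) : B :=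
  ∫ t in (0 : ℝ)..1, logIntegrand x t

theorem logIntegrand_mul_cancel {x : B} {t : ℝ} (h : IsUnit (1 + t • (x - 1))) :
    logIntegrand x t * (1 + t • (x - 1)) = x - 1 := by
  rw [logIntegrand, mul_assoc, Ring.inverse_mul_cancel _ h, mul_one]

variable [CompleteSpace B]

theorem continuousOn_logIntegrand (x : B) :
    ContinuousOn (logIntegrand x) {t | IsUnit (1 + t • (x - 1))} := by
  rintro t ⟨u, hu⟩
  have hinv : ContinuousAt Ring.inverse (1 + t • (x - 1)) := hu ▸ NormedRing.inverse_continuousAt u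
  have hseg : ContinuousAt (fun s : ℝ ↦ 1 + s • (x - 1)) t := by fun_prop
  have hinvseg : ContinuousAt (fun s : ℝ ↦ (1 + s • (x - 1))⁻¹ʳ) t :=
    ContinuousAt.comp (f := fun s : ℝ ↦ 1 + s • (x - 1)) hinv hseg
  exact (continuousAt_const.mul hinvseg).continuousWithinAt

theorem intervalIntegrable_logIntegrand {x : B} {b : ℝ} (hb : 0 ≤ b)
    (h : ∀ t ∈ Icc 0 b, IsUnit (1 + t • (x - 1))) :
    IntervalIntegrable (logIntegrand x) MeasureTheory.volume 0 b :=
  ((continuousOn_logIntegrand x).mono h).intervalIntegrable_of_Icc hb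

theorem hasDerivAt_integral_logIntegrand {x : B} {t : ℝ} (ht : 0 ≤ t)
    (h : ∀ s ∈ Icc 0 t, IsUnit (1 + s • (x - 1))) :
    HasDerivAt (fun s ↦ ∫ r in (0 : ℝ)..s, logIntegrand x r) (logIntegrand x t) t := by
  have hopen : IsOpen {s : ℝ | IsUnit (1 + s • (x - 1))} :=
    Units.isOpen.preimage (by fun_prop : Continuous fun s : ℝ ↦ 1 + s • (x - 1))
  have hmem : t ∈ {s : ℝ | IsUnit (1 + s • (x - 1))} := h t ⟨ht, le_rfl⟩
  exact intervalIntegral.integral_hasDerivAt_right (intervalIntegrable_logIntegrand ht h)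
    ((continuousOn_logIntegrand x).stronglyMeasurableAtFilter hopen t hmem)
    ((continuousOn_logIntegrand x).continuousAt (hopen.mem_nhds hmem))

theorem exp_integralLog {x : B} (h : ∀ t ∈ Icc (0 : ℝ) 1, IsUnit (1 + t • (x - 1))) :
    exp (integralLog x) = x := by
  let _ : NormedAlgebra ℚ B := .restrictScalars ℚ ℝ B
  let F (s : ℝ) : B := ∫ r in (0 : ℝ)..s, logIntegrand x r
  have hderiv : ∀ t ∈ Icc (0 : ℝ) 1,
      HasDerivAt (fun s ↦ exp (-F s) * (1 + s • (x - 1))) 0 t := by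
    intro t ht
    have hF : HasDerivAt F (logIntegrand x t) t :=
      hasDerivAt_integral_logIntegrand ht.1 fun s hs ↦ h s ⟨hs.1, hs.2.trans ht.2⟩
    have hexp : HasDerivAt (fun s ↦ exp (-F s)) (exp (-F t) * -logIntegrand x t) t := by
      simpa [Function.comp_def] using (hasFDerivAt_exp (𝕂 := ℝ)).comp_hasDerivAt t hF.fun_neg
    have hseg : HasDerivAt (fun s : ℝ ↦ 1 + s • (x - 1)) (x - 1) t := by
      simpa using ((hasDerivAt_id t).smul_const (x - 1)).const_add 1
    refine (hexp.mul hseg).congr_deriv ?_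
    rw [mul_assoc, neg_mul, logIntegrand_mul_cancel (h t ht), mul_neg, neg_add_cancel]
  have hconst : exp (-F 1) * (1 + (1 : ℝ) • (x - 1)) = exp (-F 0) * (1 + (0 : ℝ) • (x - 1)) :=
    constant_of_has_deriv_right_zero
      (fun t ht ↦ (hderiv t ht).continuousAt.continuousWithinAt)
      (fun t ht ↦ (hderiv t ⟨ht.1, ht.2.le⟩).hasDerivWithinAt) 1 (right_mem_Icc.2 zero_le_one)
  have hone : exp (-integralLog x) * x = 1 := by
    simpa [F, integralLog] using hconst
  calc exp (integralLog x)
      = exp (integralLog x) * (exp (-integralLog x) * x) := by rw [hone, mul_one]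
    _ = x := by rw [← mul_assoc, ← exp_add, add_neg_cancel, exp_zero, one_mul]

end IntegralLog

/-- The open strip `-π < Im z < π`, the range of the principal branch of the logarithm on the slit
plane. -/
def principalStrip : Set ℂ := {z | z.im ∈ Ioo (-Real.pi) Real.pi}

theorem injOn_exp_principalStrip : InjOn Complex.exp principalStrip :=
  Complex.expOpenPartialHomeomorph.injOn

theorem log_mem_principalStrip {z : ℂ} (hz : z ∈ slitPlane) : Complex.log z ∈ principalStrip :=
  Complex.expOpenPartialHomeomorph.map_target hz

theorem exp_mem_slitPlane_of_mem_principalStrip {z : ℂ} (hz : z ∈ principalStrip) :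
    Complex.exp z ∈ slitPlane :=
  Complex.expOpenPartialHomeomorph.map_source hz

section Commutative

variable {B : Type*} [NormedCommRing B] [NormedAlgebra ℂ B]

theorem character_one_add_smul_sub_one (φ : characterSpace ℂ B) (b : B) (t : ℝ) :
    φ (1 + t • (b - 1)) = 1 + t • (φ b - 1) := by
  rw [← Complex.coe_smul, ← Complex.coe_smul, map_add, map_smul, map_sub, map_one]

theorem character_logIntegrand (φ : characterSpace ℂ B) {b : B} {t : ℝ}
    (h : IsUnit (1 + t • (b - 1))) :
    φ (logIntegrand b t) = (φ b - 1) * (1 + t • (φ b - 1))⁻¹ := by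
  have hunit : 1 + t • (φ b - 1) ≠ 0 :=
    character_one_add_smul_sub_one φ b t ▸ (h.map φ).ne_zero
  rw [eq_mul_inv_iff_mul_eq₀ hunit, ← character_one_add_smul_sub_one, ← map_mul,
    logIntegrand_mul_cancel h, map_sub, map_one]

variable [CompleteSpace B]

theorem isUnit_of_forall_character_ne_zero {b : B} (h : ∀ φ : characterSpace ℂ B, φ b ≠ 0) :
    IsUnit b := by
  by_contra hb
  obtain ⟨φ, hφ⟩ := CharacterSpace.exists_apply_eq_zero hb
  exact h φ hφ

theorem character_exp (φ : characterSpace ℂ B) (b : B) : φ (exp b) = Complex.exp (φ b) := by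
  let _ : NormedAlgebra ℚ B := .restrictScalars ℚ ℂ B
  rw [map_exp φ (map_continuous φ), Complex.exp_eq_exp_ℂ]

theorem isUnit_one_add_smul_sub_one {b : B} (hb : spectrum ℂ b ⊆ slitPlane) {t : ℝ}
    (ht : t ∈ Icc (0 : ℝ) 1) : IsUnit (1 + t • (b - 1)) := by
  refine isUnit_of_forall_character_ne_zero fun φ ↦ ?_
  have hφ : 1 + (φ b - 1) ∈ slitPlane := by
    simpa using hb (CharacterSpace.apply_mem_spectrum φ b)
  rw [character_one_add_smul_sub_one]
  exact Complex.slitPlane_ne_zero (Complex.starConvex_one_slitPlane.add_smul_mem hφ ht.1 ht.2)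

theorem character_integralLog (φ : characterSpace ℂ B) {b : B} (hb : spectrum ℂ b ⊆ slitPlane) :
    φ (integralLog b) = Complex.log (φ b) := by
  have hunit : ∀ t ∈ Icc (0 : ℝ) 1, IsUnit (1 + t • (b - 1)) :=
    fun _ ↦ isUnit_one_add_smul_sub_one hb
  have hφ : 1 + (φ b - 1) ∈ slitPlane := by
    simpa using hb (CharacterSpace.apply_mem_spectrum φ b)
  calc φ (integralLog b)
      = ∫ t in (0 : ℝ)..1, φ (logIntegrand b t) :=
        ((CharacterSpace.toCLM φ).intervalIntegral_comp_comm
          (intervalIntegrable_logIntegrand (zero_le_one' ℝ) hunit)).symm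
    _ = ∫ t in (0 : ℝ)..1, (φ b - 1) * (1 + t • (φ b - 1))⁻¹ :=
        intervalIntegral.integral_congr fun t ht ↦
          character_logIntegrand φ (hunit t (uIcc_of_le (zero_le_one' ℝ) ▸ ht))
    _ = Complex.log (φ b) := by
        rw [intervalIntegral.integral_const_mul, ← Complex.log_eq_integral hφ, add_sub_cancel]

theorem spectrum_integralLog_subset {b : B} (hb : spectrum ℂ b ⊆ slitPlane) :
    spectrum ℂ (integralLog b) ⊆ principalStrip := by
  intro z hz
  obtain ⟨φ, rfl⟩ := CharacterSpace.mem_spectrum_iff_exists.1 hz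
  rw [character_integralLog φ hb]
  exact log_mem_principalStrip (hb (CharacterSpace.apply_mem_spectrum φ b))

theorem spectrum_exp_of_comm (b : B) : spectrum ℂ (exp b) = Complex.exp '' spectrum ℂ b := by
  ext z
  simp [CharacterSpace.mem_spectrum_iff_exists, character_exp]

theorem character_integral_exp_smul (φ : characterSpace ℂ B) (d : B) :
    φ (∫ s in (0 : ℝ)..1, exp (s • d)) = ∫ s in (0 : ℝ)..1, Complex.exp (s • φ d) := by
  calc φ (∫ s in (0 : ℝ)..1, exp (s • d))
      = ∫ s in (0 : ℝ)..1, φ (exp (s • d)) :=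
        ((CharacterSpace.toCLM φ).intervalIntegral_comp_comm
          (intervalIntegrable_exp_smul d 0 1)).symm
    _ = ∫ s in (0 : ℝ)..1, Complex.exp (s • φ d) := by
        simp only [character_exp, ← Complex.coe_smul, map_smul]

theorem eq_zero_of_exp_eq_one {d : B} (hexp : exp d = 1)
    (hd : ∀ φ : characterSpace ℂ B, φ d = 0) : d = 0 := by
  have hunit : IsUnit (∫ s in (0 : ℝ)..1, exp (s • d)) :=
    isUnit_of_forall_character_ne_zero fun φ ↦ by
      simp [character_integral_exp_smul, hd]
  rw [← hunit.mul_left_eq_zero, mul_integral_exp_smul, hexp, sub_self]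

theorem eq_of_exp_eq_exp_of_comm {a b : B} (ha : spectrum ℂ a ⊆ principalStrip)
    (hb : spectrum ℂ b ⊆ principalStrip) (h : exp a = exp b) : a = b := by
  let _ : NormedAlgebra ℚ B := .restrictScalars ℚ ℂ B
  rw [← sub_eq_zero]
  refine eq_zero_of_exp_eq_one ?_ fun φ ↦ ?_
  · rw [sub_eq_add_neg, exp_add, h, ← exp_add, add_neg_cancel, exp_zero]
  · rw [map_sub, sub_eq_zero]
    refine injOn_exp_principalStrip (ha (CharacterSpace.apply_mem_spectrum φ a))
      (hb (CharacterSpace.apply_mem_spectrum φ b)) ?_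
    rw [← character_exp, ← character_exp, h]

end Commutative

section Bicommutant

theorem spectrum_coe_centralizer {R A : Type*} [CommRing R] [Ring A] [Algebra R A] {s : Set A}
    (a : Subalgebra.centralizer R s) : spectrum R (a : A) = spectrum R a := by
  refine Subset.antisymm (fun z hz hu ↦ hz (hu.map (Subalgebra.centralizer R s).val)) ?_
  intro z hz ⟨u, hu⟩
  have hmem : (u : A) ∈ Subalgebra.centralizer R s :=
    hu ▸ (algebraMap R (Subalgebra.centralizer R s) z - a).2
  have hinv : (↑u⁻¹ : A) ∈ Subalgebra.centralizer R s := fun c hc ↦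
    (show Commute c (u : A) from hmem c hc).units_inv_right
  refine hz ⟨⟨⟨u, hmem⟩, ⟨↑u⁻¹, hinv⟩, Subtype.ext u.mul_inv, Subtype.ext u.inv_mul⟩, ?_⟩
  exact Subtype.ext hu

variable {A : Type*} [NormedRing A] [NormedAlgebra ℂ A]

/-- The double centralizer of a set. It is closed under inverses, so that spectra may be computed
in it, and if the elements of the set commute pairwise, it is a commutative Banach algebra, so that
Gelfand theory applies. -/
abbrev bicommutant (s : Set A) : Subalgebra ℂ A :=
  Subalgebra.centralizer ℂ s.centralizer

/-- The commutative Banach algebra structure of the double centralizer of a commuting set. -/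
abbrev bicommutantNormedCommRing {s : Set A} (hs : ∀ a ∈ s, ∀ b ∈ s, a * b = b * a) :
    NormedCommRing (bicommutant s) where
  __ := SubringClass.toNormedRing (bicommutant s)
  mul_comm a b := Subtype.ext (centralizer_centralizer_comm_of_comm hs a a.2 b b.2)

theorem mem_bicommutant {s : Set A} {a : A} (ha : a ∈ s) : a ∈ bicommutant s :=
  subset_centralizer_centralizer ha

variable [CompleteSpace A]

instance completeSpace_bicommutant (s : Set A) : CompleteSpace (bicommutant s) :=
  (isClosed_centralizer s.centralizer).completeSpace_coe

theorem coe_exp_bicommutant {s : Set A} (a : bicommutant s) :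
    ((exp a : bicommutant s) : A) = exp (a : A) := by
  let _ : NormedAlgebra ℚ (bicommutant s) := .restrictScalars ℚ ℂ _
  let _ : NormedAlgebra ℚ A := .restrictScalars ℚ ℂ A
  exact map_exp (bicommutant s).val continuous_subtype_val a

theorem spectrum_exp (a : A) : spectrum ℂ (exp a) = Complex.exp '' spectrum ℂ a := by
  let _ := bicommutantNormedCommRing (s := {a}) (by simp)
  let a' : bicommutant {a} := ⟨a, mem_bicommutant rfl⟩
  have h : spectrum ℂ (exp a') = Complex.exp '' spectrum ℂ a' := spectrum_exp_of_comm a'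
  rwa [← spectrum_coe_centralizer, ← spectrum_coe_centralizer, coe_exp_bicommutant] at h

theorem eq_of_exp_eq_exp_of_commute {a b : A} (hab : Commute a b)
    (ha : spectrum ℂ a ⊆ principalStrip) (hb : spectrum ℂ b ⊆ principalStrip)
    (h : exp a = exp b) : a = b := by
  let _ := bicommutantNormedCommRing (s := {a, b}) (by simp [hab.eq])
  let a' : bicommutant {a, b} := ⟨a, mem_bicommutant (by simp)⟩
  let b' : bicommutant {a, b} := ⟨b, mem_bicommutant (by simp)⟩
  have hexp : exp a' = exp b' := Subtype.ext <| by
    rw [coe_exp_bicommutant, coe_exp_bicommutant, h]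
  have h' : a' = b' := eq_of_exp_eq_exp_of_comm ((spectrum_coe_centralizer a').symm.trans_subset ha)
    ((spectrum_coe_centralizer b').symm.trans_subset hb) hexp
  exact congrArg Subtype.val h'

theorem exists_mem_bicommutant_exp_eq {x : A} (hx : spectrum ℂ x ⊆ slitPlane) :
    ∃ a ∈ bicommutant {x}, spectrum ℂ a ⊆ principalStrip ∧ exp a = x := by
  let _ := bicommutantNormedCommRing (s := {x}) (by simp)
  let x' : bicommutant {x} := ⟨x, mem_bicommutant rfl⟩
  have hx' : spectrum ℂ x' ⊆ slitPlane := (spectrum_coe_centralizer x').symm.trans_subset hx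
  let a' : bicommutant {x} := integralLog x'
  refine ⟨a', a'.2, ?_, ?_⟩
  · rw [spectrum_coe_centralizer]
    exact spectrum_integralLog_subset hx'
  · rw [← coe_exp_bicommutant, exp_integralLog fun _ ↦ isUnit_one_add_smul_sub_one hx']

theorem mapsTo_exp :
    MapsTo exp {a : A | spectrum ℂ a ⊆ principalStrip} {x | spectrum ℂ x ⊆ slitPlane} := by
  intro a ha
  rw [mem_ofPred_eq, spectrum_exp, image_subset_iff]
  exact fun z hz ↦ exp_mem_slitPlane_of_mem_principalStrip (ha hz)

theorem injOn_exp : InjOn exp {a : A | spectrum ℂ a ⊆ principalStrip} := by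
  intro a ha b hb hab
  obtain ⟨p, hp_mem, hp, hexp⟩ := exists_mem_bicommutant_exp_eq (mapsTo_exp ha)
  let _ : NormedAlgebra ℚ A := .restrictScalars ℚ ℂ A
  have hcomm {c : A} (hc : exp c = exp a) : Commute c p := by
    refine hp_mem c ?_
    rintro _ rfl
    exact hc ▸ (Commute.refl c).exp_left
  have hap : a = p := eq_of_exp_eq_exp_of_commute (hcomm rfl) ha hp hexp.symm
  have hbp : b = p := eq_of_exp_eq_exp_of_commute (hcomm hab.symm) hb hp (hab ▸ hexp.symm)
  rw [hap, hbp]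

theorem bijOn_exp :
    BijOn exp {a : A | spectrum ℂ a ⊆ principalStrip} {x | spectrum ℂ x ⊆ slitPlane} :=
  ⟨mapsTo_exp, injOn_exp, fun _ hx ↦
    let ⟨a, _, ha, hexp⟩ := exists_mem_bicommutant_exp_eq hx
    ⟨a, ha, hexp⟩⟩

end Bicommutant

section Spectrum

variable {ι : Type*} [Fintype ι] [DecidableEq ι]

theorem hasEigenvalue_toLin'_iff {K : Type*} [Field K] {M : Matrix ι ι K} {z : K} :
    Module.End.HasEigenvalue (Matrix.toLin' M) z ↔ z ∈ spectrum K M := by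
  rw [Module.End.hasEigenvalue_iff_mem_spectrum, Matrix.spectrum_toLin']

theorem spectrum_transpose {R : Type*} [CommRing R] (M : Matrix ι ι R) :
    spectrum R Mᵀ = spectrum R M := by
  ext z
  rw [spectrum.mem_iff, spectrum.mem_iff, ← Matrix.isUnit_transpose, Matrix.transpose_sub,
    Matrix.transpose_transpose, Matrix.algebraMap_eq_diagonal, Matrix.diagonal_transpose]

end Spectrum

open scoped Matrix.Norms.Operator

variable {n : ℕ} {X L L' : Matrix (Fin n) (Fin n) ℂ}

theorem NoNonposEigenvalue.spectrum_subset_slitPlane (hX : NoNonposEigenvalue X) :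
    spectrum ℂ X ⊆ slitPlane := by
  intro z hz
  by_contra hslit
  rw [Complex.mem_slitPlane_iff, not_or, not_lt, not_not] at hslit
  obtain ⟨hre, him⟩ := hslit
  refine hX z.re hre (hasEigenvalue_toLin'_iff.2 ?_)
  rwa [show (z.re : ℂ) = z from Complex.ext rfl him.symm]

theorem isPrincipalLog_iff :
    IsPrincipalLog X L ↔ exp L = X ∧ spectrum ℂ L ⊆ principalStrip :=
  ⟨fun h ↦ ⟨h.exp_eq, fun z hz ↦ h.eigenvalue_im z (hasEigenvalue_toLin'_iff.2 hz)⟩,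
    fun h ↦ ⟨h.1, fun _ hz ↦ h.2 (hasEigenvalue_toLin'_iff.1 hz)⟩⟩

theorem NoNonposEigenvalue.exists_isPrincipalLog (hX : NoNonposEigenvalue X) :
    ∃ L, IsPrincipalLog X L :=
  let ⟨L, hspec, hexp⟩ := bijOn_exp.surjOn hX.spectrum_subset_slitPlane
  ⟨L, isPrincipalLog_iff.2 ⟨hexp, hspec⟩⟩

theorem neg_mem_principalStrip_iff {z : ℂ} : -z ∈ principalStrip ↔ z ∈ principalStrip := by
  simp [principalStrip, neg_lt, and_comm]

theorem star_mem_principalStrip_iff {z : ℂ} : star z ∈ principalStrip ↔ z ∈ principalStrip := by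
  simp [principalStrip, neg_lt, and_comm]

namespace IsPrincipalLog

theorem unique (hL : IsPrincipalLog X L) (hL' : IsPrincipalLog X L') : L = L' :=
  injOn_exp (isPrincipalLog_iff.1 hL).2 (isPrincipalLog_iff.1 hL').2
    (hL.exp_eq.trans hL'.exp_eq.symm)

theorem transpose (hL : IsPrincipalLog X L) : IsPrincipalLog Xᵀ Lᵀ := by
  rw [isPrincipalLog_iff] at hL ⊢
  exact ⟨by rw [Matrix.exp_transpose, hL.1], by rw [spectrum_transpose]; exact hL.2⟩

theorem conjTranspose (hL : IsPrincipalLog X L) : IsPrincipalLog Xᴴ Lᴴ := by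
  rw [isPrincipalLog_iff] at hL ⊢
  refine ⟨by rw [Matrix.exp_conjTranspose, hL.1], fun z hz ↦ ?_⟩
  rw [← Matrix.star_eq_conjTranspose, spectrum.map_star, mem_star] at hz
  exact star_mem_principalStrip_iff.1 (hL.2 hz)

theorem inv (hL : IsPrincipalLog X L) : IsPrincipalLog X⁻¹ (-L) := by
  rw [isPrincipalLog_iff] at hL ⊢
  refine ⟨by rw [Matrix.exp_neg, hL.1], fun z hz ↦ ?_⟩
  rw [← spectrum.neg_eq, mem_neg] at hz
  exact neg_mem_principalStrip_iff.1 (hL.2 hz)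

theorem conj_of_mul_eq_one {U V : Matrix (Fin n) (Fin n) ℂ} (hL : IsPrincipalLog X L)
    (h : U * V = 1) : IsPrincipalLog (U * X * V) (U * L * V) := by
  let u : (Matrix (Fin n) (Fin n) ℂ)ˣ := ⟨U, V, h, mul_eq_one_comm.1 h⟩
  have hspec : spectrum ℂ (U * L * V) = spectrum ℂ L := spectrum.units_conjugate (u := u)
  have hexp : exp (U * L * V) = U * exp L * V := Matrix.exp_units_conj u L
  rw [isPrincipalLog_iff] at hL ⊢
  exact ⟨by rw [hexp, hL.1], hspec.trans_subset hL.2⟩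

end IsPrincipalLog

theorem isRealMatrix_iff : IsRealMatrix X ↔ Xᴴᵀ = X := by
  simp only [IsRealMatrix, ← Matrix.ext_iff, Matrix.transpose_apply, Matrix.conjTranspose_apply,
    Complex.star_def, Complex.conj_eq_iff_im]

theorem Z_mul_neg_Z {m : ℕ} (h : m + m = n) : Z h * -Z h = 1 := by
  have hblocks : Matrix.fromBlocks 0 1 (-1) 0 * Matrix.fromBlocks 0 1 (-1) 0 =
      (-1 : Matrix (Fin m ⊕ Fin m) (Fin m ⊕ Fin m) ℂ) := by
    simp [Matrix.fromBlocks_multiply, ← Matrix.fromBlocks_one, Matrix.fromBlocks_neg]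
  rw [Z, Matrix.reindex_apply, mul_neg, Matrix.submatrix_mul_equiv, hblocks,
    Matrix.submatrix_neg, Pi.neg_apply, Pi.neg_apply, neg_neg, Matrix.submatrix_one_equiv]

theorem dual_eq_conj {m : ℕ} (h : m + m = n) (Y : Matrix (Fin n) (Fin n) ℂ) :
    dual h Y = Z h * Yᵀ * -Z h :=
  (mul_neg _ _).symm

namespace IsPrincipalLog

theorem conjTranspose_eq_neg (hL : IsPrincipalLog X L) (hX : X ∈ Matrix.unitaryGroup (Fin n) ℂ) :
    Lᴴ = -L := by
  have hinv : Xᴴ⁻¹ = X := Matrix.inv_eq_right_inv (Matrix.mem_unitaryGroup_iff'.1 hX)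
  have h : IsPrincipalLog X (-Lᴴ) := hinv ▸ hL.conjTranspose.inv
  exact (neg_eq_iff_eq_neg.2 (hL.unique h)).symm

theorem isSymm (hL : IsPrincipalLog X L) (hX : X.IsSymm) : L.IsSymm :=
  unique (hX.eq ▸ hL.transpose) hL

theorem isRealMatrix (hL : IsPrincipalLog X L) (hX : IsRealMatrix X) : IsRealMatrix L :=
  isRealMatrix_iff.2 (unique (isRealMatrix_iff.1 hX ▸ hL.conjTranspose.transpose) hL)

theorem isSelfDual {m : ℕ} (h : m + m = n) (hL : IsPrincipalLog X L) (hX : IsSelfDual h X) :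
    IsSelfDual h L := by
  have hdual : IsPrincipalLog (dual h X) (dual h L) := by
    simpa only [dual_eq_conj] using hL.transpose.conj_of_mul_eq_one (Z_mul_neg_Z h)
  exact unique (hX ▸ hdual) hL

theorem conj_eq_conjTranspose {U V : Matrix (Fin n) (Fin n) ℂ} (hL : IsPrincipalLog X L)
    (hUV : U * V = 1) (hX : U * X * V = Xᴴ) : U * L * V = Lᴴ :=
  unique (hX ▸ hL.conj_of_mul_eq_one hUV) hL.conjTranspose

end IsPrincipalLog

end MatrixLog

theorem mainTheorem5_general {n : ℕ} (X : Matrix (Fin n) (Fin n) ℂ)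
    (hX : MatrixLog.NoNonposEigenvalue X) :
    (∃! L : Matrix (Fin n) (Fin n) ℂ, MatrixLog.IsPrincipalLog X L) ∧
    ∀ L : Matrix (Fin n) (Fin n) ℂ, MatrixLog.IsPrincipalLog X L →
      (X ∈ Matrix.unitaryGroup (Fin n) ℂ → L.conjTranspose = -L) ∧
      (X.IsSymm → L.IsSymm) ∧
      (MatrixLog.IsRealMatrix X → MatrixLog.IsRealMatrix L) ∧
      (∀ (m : ℕ) (hm : m + m = n), MatrixLog.IsSelfDual hm X → MatrixLog.IsSelfDual hm L) ∧
      (∀ U V : Matrix (Fin n) (Fin n) ℂ, U * V = 1 →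
        U * X * V = X.conjTranspose → U * L * V = L.conjTranspose) := by
  obtain ⟨L₀, hL₀⟩ := hX.exists_isPrincipalLog
  exact ⟨⟨L₀, hL₀, fun _ hL ↦ hL.unique hL₀⟩, fun L hL ↦ ⟨hL.conjTranspose_eq_neg, hL.isSymm,
    hL.isRealMatrix, fun _ hm ↦ hL.isSelfDual hm, fun _ _ ↦ hL.conj_eq_conjTranspose⟩⟩

theorem mainTheorem5 {n : ℕ} (X : Matrix (Fin n) (Fin n) ℂ)
    (hX : MatrixLog.NoNonposEigenvalue X) :
    (∃! L : Matrix (Fin n) (Fin n) ℂ, MatrixLog.IsPrincipalLog X L) ∧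
    ∀ L : Matrix (Fin n) (Fin n) ℂ, MatrixLog.IsPrincipalLog X L →
      (X ∈ Matrix.unitaryGroup (Fin n) ℂ → L.conjTranspose = -L) ∧
      (X.IsSymm → L.IsSymm) ∧
      (MatrixLog.IsRealMatrix X → MatrixLog.IsRealMatrix L) ∧
      (∀ (m : ℕ) (hm : m + m = n), MatrixLog.IsSelfDual hm X → MatrixLog.IsSelfDual hm L) ∧
      (∀ Γ : Matrix (Fin n) (Fin n) ℂ, Γ ∈ Matrix.unitaryGroup (Fin n) ℂ → Γ * Γ = 1 →
        Γ * X * Γ = X.conjTranspose → Γ * L * Γ = L.conjTranspose) :=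
  (mainTheorem5_general X hX).imp_right fun h L hL ↦
    (h L hL).imp_right <| .imp_right <| .imp_right <| .imp_right fun hconj Γ _ ↦ hconj Γ Γ
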